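/- Let $\Sigma$ be a finite alphabet and let $\#,\$\notin\Sigma$ be two end-markers. A 1-way probabilistic reversible C-automaton (PRA-C) $A=(Q,\Sigma,q_0,Q_F,\delta)$ consists of a finite set of states $Q$, an initial state $q_0\in Q$, a set of accepting states $Q_F\subseteq Q$ and a transition function $\delta: Q\times(\Sigma\cup\{\#,\$\})\times Q\to[0,1]$ such that $\sum_{q'\in Q}\delta(q,\sigma,q')=1$ and $\sum_{q'\in Q}\delta(q',\sigma,q)=1$ for all $q\in Q$ and $\sigma\in\Sigma\cup\{\#,\$\}$. On input $w\in\Sigma^*$ the automaton starts in $q_0$ and reads $\#w\$$ from left to right; in state $q$, reading $\sigma$, it moves to $q'$ with probability $\delta(q,\sigma,q')$. Let $P_{w,A}$ be the probability that it is in a state of $Q_F$ after reading the whole of $\#w\$$. The automaton $A$ recognizes a language $L\subseteq\Sigma^*$ with bounded error if $p_1<p_2$, where $p_1=\sup\{P_{w,A}\mid w\notin L\}$ and $p_2=\inf\{P_{w,A}\mid w\in L\}$ (supremum and infimum in $[0,1]$). For a state $q$ of a deterministic finite automaton and a word $w$, let $qw$ be the state reached from $q$ by reading $w$. For words $x,y$,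 let $(x,y)^*$ be the set of all finite concatenations of copies of $x$ and $y$, including the empty word. A regular language $L\subseteq\Sigma^*$ is of type $(*)$ if in the minimal complete deterministic finite automaton recognizing $L$ there are states $q,q_1,q_2$ and words $x,y\in\Sigma^*$ such that 1. $q_1\neq q_2$; 2. $qx=q_1$ and $qy=q_2$; 3. $q_1x=q_1$ and $q_2y=q_2$; 4. for every $t\in(x,y)^*$ there is $t_1\in(x,y)^*$ with $q_1tt_1=q_1$; 5. for every $t\in(x,y)^*$ there is $t_2\in(x,y)^*$ with $q_2tt_2=q_2$. Theorem. If a regular language is of type $(*)$, then it is not recognized with bounded error by any PRA-C. -/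

import Mathlib

/-- The tape alphabet `Γ = Σ ∪ {#, $}`: the input letters together with two fresh end-markers. -/
inductive TapeSymbol (α : Type*) where
  /-- an input letter -/
  | letter (a : α) : TapeSymbol α
  /-- the left end-marker `#` -/
  | leftEnd : TapeSymbol α
  /-- the right end-marker `$` -/
  | rightEnd : TapeSymbol α

/-- The tape content `# w $` of an input word `w`. -/
def tapeOf {α : Type*} (w : List α) : List (TapeSymbol α) :=
  TapeSymbol.leftEnd :: (w.map TapeSymbol.letter ++ [TapeSymbol.rightEnd])

/-- A 1-way probabilistic reversible C-automaton with finite input alphabet `α` and finite set of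
states `Q`: an initial state, a set of accepting states (the other states are rejecting), and a
transition function into the real interval `[0,1]`, where `δ q σ q'` is the probability to move
from `q` to `q'` on reading `σ`, such that for every tape symbol both the outgoing and the
incoming probabilities of every state sum to one. -/
structure PRAC (α : Type*) (Q : Type*) [Fintype α] [Fintype Q] where
  /-- the initial state -/
  start : Q
  /-- the accepting states -/
  accept : Set Q
  /-- the transition function -/
  δ : Q → TapeSymbol α → Q → ℝ
  δ_mem : ∀ q σ q', δ q σ q' ∈ Set.Icc (0 : ℝ) 1
  sum_out : ∀ q σ, ∑ q', δ q σ q' = 1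
  sum_in : ∀ q σ, ∑ q', δ q' σ q = 1

namespace PRAC

variable {α Q : Type*} [Fintype α] [Fintype Q] (A : PRAC α Q)

/-- The matrix `V_σ` with entries `(V_σ) i j = δ (j, σ, i)`. -/
def V (σ : TapeSymbol α) : Matrix Q Q ℝ := Matrix.of fun i j => A.δ j σ i

/-- The distribution over states after reading `u` from the distribution `v`. -/
def evolve (v : Q → ℝ) (u : List (TapeSymbol α)) : Q → ℝ :=
  u.foldl (fun p σ => (A.V σ).mulVec p) v

open Classical in
/-- The initial distribution, concentrated in the initial state. -/
noncomputable def initDist : Q → ℝ := Pi.single A.start 1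

/-- The distribution over states after the whole tape `# w $` has been read. -/
noncomputable def finalDist (w : List α) : Q → ℝ := A.evolve A.initDist (tapeOf w)

theorem evolve_mem (u : List (TapeSymbol α)) (v : Q → ℝ) (hv : v ∈ stdSimplex ℝ Q) :
    A.evolve v u ∈ stdSimplex ℝ Q := by
  induction u generalizing v with
  | nil => exact hv
  | cons σ u ih =>
    refine ih _ ⟨fun i => Finset.sum_nonneg fun j _ =>
      mul_nonneg (A.δ_mem j σ i).1 (hv.1 j), ?_⟩
    have h : ∀ j, ∑ i, A.δ j σ i * v j = v j := fun j => by
      rw [← Finset.sum_mul, A.sum_out, one_mul]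
    simp only [Matrix.mulVec, dotProduct, V, Matrix.of_apply]
    rw [Finset.sum_comm]
    simp only [h, hv.2]

theorem finalDist_mem (w : List α) : A.finalDist w ∈ stdSimplex ℝ Q := by
  classical
  refine A.evolve_mem _ _ ?_
  unfold initDist
  convert single_mem_stdSimplex ℝ A.start

open Classical in
/-- The probability `P_{w,A}` that `A` accepts `w` (classical acceptance: being in an accepting
state after the whole tape has been read), as an element of `[0,1]`. -/
noncomputable def acceptProb (w : List α) : unitInterval :=
  ⟨∑ q with q ∈ A.accept, A.finalDist w q,
    Finset.sum_nonneg fun q _ => (A.finalDist_mem w).1 q,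
    (Finset.sum_le_univ_sum_of_nonneg (A.finalDist_mem w).1).trans_eq (A.finalDist_mem w).2⟩

/-- `A` recognizes `L` with bounded error with interval `(p₁, p₂)`: `p₁ < p₂`, and `p₁` is the
supremum of the acceptance probabilities of the words outside `L` and `p₂` the infimum of those of
the words in `L`. Both bounds are taken in `[0,1]`, so an empty supremum is `0` and an empty
infimum is `1`. -/
def RecognizesWithInterval (L : Language α) (p₁ p₂ : unitInterval) : Prop :=
  p₁ < p₂ ∧ IsLUB {p | ∃ w, w ∉ L ∧ A.acceptProb w = p} p₁ ∧
    IsGLB {p | ∃ w, w ∈ L ∧ A.acceptProb w = p} p₂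

/-- `A` recognizes `L` with bounded error. -/
def RecognizesWithBoundedError (L : Language α) : Prop :=
  ∃ p₁ p₂ : unitInterval, A.RecognizesWithInterval L p₁ p₂

end PRAC

/-- `D` is a minimal deterministic automaton of `L`: it recognizes `L`, and no (complete)
deterministic finite automaton that recognizes `L` has fewer states. -/
def IsMinimalDFA {α σ : Type*} [Fintype σ] (D : DFA α σ) (L : Language α) : Prop :=
  D.accepts = L ∧
    ∀ (τ : Type) [Fintype τ] (E : DFA α τ), E.accepts = L → Fintype.card σ ≤ Fintype.card τ

open scoped Computability in
/-- The construction `(*)` in a deterministic automaton; `({x, y} : Language α)∗` is the set of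
all finite concatenations of copies of the words `x` and `y`. -/
def HasStarConstruction {α σ : Type*} (D : DFA α σ) : Prop :=
  ∃ (q q₁ q₂ : σ) (x y : List α),
    q₁ ≠ q₂ ∧
    D.evalFrom q x = q₁ ∧ D.evalFrom q y = q₂ ∧
    D.evalFrom q₁ x = q₁ ∧ D.evalFrom q₂ y = q₂ ∧
    (∀ t ∈ ({x, y} : Language α)∗, ∃ t₁ ∈ ({x, y} : Language α)∗, D.evalFrom q₁ (t ++ t₁) = q₁) ∧
    (∀ t ∈ ({x, y} : Language α)∗, ∃ t₂ ∈ ({x, y} : Language α)∗, D.evalFrom q₂ (t ++ t₂) = q₂)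

/-- A language is of type `(*)` if its minimal deterministic finite automaton, which is unique up
to isomorphism, has the construction `(*)`. -/
def IsOfTypeStar {α : Type*} (L : Language α) : Prop :=
  ∃ (σ : Type) (_ : Fintype σ) (D : DFA α σ), IsMinimalDFA D L ∧ HasStarConstruction D

/-!
The transition matrices of a PRA-C are doubly stochastic, so they are contractions of the Euclidean
norm on the space of (signed) distributions. For a monoid `K` of contractions of a
finite-dimensional Euclidean space let `H` be the subspace on which all of `K` acts isometrically
(`isometricPart`). It is `K`-invariant, and so is its orthogonal complement. On `H` every operator
is an isometry, so its powers return arbitrarily close to the identity on any given vector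
(`exists_pow_succ_apply_near`). On the complement, suppose that a submonoid `C ≤ K` can be reached
from everywhere in `K`, in the sense that every `T ∈ K` has an `S ∈ K` with `S * T ∈ C`; then a
compactness argument shows that operators of `C` make any given vector arbitrarily short
(`exists_norm_apply_lt`). Hence for every `X ∈ K` some `S * X ^ (n + 1)` with `S ∈ C` takes a vector
arbitrarily close to its orthogonal projection to `H`, and this limit depends only on `K`
(`exists_mul_pow_succ_apply_near`).

Let `K` consist of the operators of the words in `(x, y)*`. Conditions 4 and 5 of the construction
`(*)` say that the operators of the words that loop at `q₁`, and of those that loop at `q₂`, are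
submonoids `C` of this kind. Thus there are words leading from `q` to `q₁` (powers of `x` followed
by loops) and words leading from `q` to `q₂` (powers of `y` followed by loops) that take the
distribution reached at `q` arbitrarily close to one and the same vector
(`PRAC.exists_word_near`). In the minimal automaton `q` is reachable and `q₁`, `q₂` are separated by
some word `z`; appending `z` gives a word in `L` and a word outside `L` whose acceptance
probabilities are arbitrarily close, which contradicts bounded error.
-/

/-! ### Monoids of contractions -/

section Contractions

open ContinuousLinearMap

variable {E : Type*} [NormedAddCommGroup E] [InnerProductSpace ℝ E] [FiniteDimensional ℝ E]

/-- A contraction that preserves the norm of a vector is inverted there by its adjoint. -/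
theorem adjoint_apply_apply_of_norm_eq {T : E →L[ℝ] E} (hT : ‖T‖ ≤ 1) {v : E}
    (hv : ‖T v‖ = ‖v‖) : adjoint T (T v) = v := by
  have h1 : ‖adjoint T (T v)‖ ≤ ‖v‖ := by
    rw [← hv]
    refine (adjoint T).le_of_opNorm_le (c := 1) ?_ (T v) |>.trans_eq (one_mul _)
    rwa [LinearIsometryEquiv.norm_map]
  have h2 : inner ℝ (adjoint T (T v)) v = ‖v‖ ^ 2 := by
    rw [adjoint_inner_left, real_inner_self_eq_norm_sq, hv]
  have h3 : ‖adjoint T (T v) - v‖ ^ 2 ≤ 0 := by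
    rw [norm_sub_sq_real, h2]
    nlinarith [norm_nonneg (adjoint T (T v))]
  rw [← sub_eq_zero, ← norm_eq_zero]
  exact pow_eq_zero_iff two_ne_zero |>.1 (le_antisymm h3 (sq_nonneg _))

/-- The largest subspace on which every operator of `K` acts isometrically. For contractions
`‖T v‖ = ‖v‖` is the linear condition `T† T v = v`, which is the form used here. -/
def isometricPart (K : Submonoid (E →L[ℝ] E)) : Submodule ℝ E where
  carrier := {v | ∀ T ∈ K, adjoint T (T v) = v}
  add_mem' hv hw T hT := by rw [map_add, map_add, hv T hT, hw T hT]
  zero_mem' T _ := by simp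
  smul_mem' c v hv T hT := by rw [map_smul, map_smul, hv T hT]

variable {K : Submonoid (E →L[ℝ] E)} (hK : ∀ T ∈ K, ‖T‖ ≤ 1)
include hK

theorem mem_isometricPart {v : E} : v ∈ isometricPart K ↔ ∀ T ∈ K, ‖T v‖ = ‖v‖ := by
  refine ⟨fun h T hT => ?_, fun h T hT => adjoint_apply_apply_of_norm_eq (hK T hT) (h T hT)⟩
  rw [← sq_eq_sq₀ (norm_nonneg _) (norm_nonneg _), ← real_inner_self_eq_norm_sq,
    ← adjoint_inner_left, h T hT, real_inner_self_eq_norm_sq]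

theorem apply_mem_isometricPart {T : E →L[ℝ] E} (hT : T ∈ K) {v : E} (hv : v ∈ isometricPart K) :
    T v ∈ isometricPart K := by
  rw [mem_isometricPart hK] at hv ⊢
  intro S hS
  rw [hv T hT]
  exact hv (S * T) (mul_mem hS hT)

/-- The orthogonal complement is invariant as well, because the operators, being injective on the
finite-dimensional isometric part, map it onto itself. -/
theorem apply_mem_orthogonal_isometricPart {T : E →L[ℝ] E} (hT : T ∈ K) {v : E}
    (hv : v ∈ (isometricPart K)ᗮ) : T v ∈ (isometricPart K)ᗮ := by
  let R : isometricPart K →ₗ[ℝ] isometricPart K :=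
    T.toLinearMap.restrict fun _ => apply_mem_isometricPart hK hT
  have hinj : Function.Injective R := by
    rw [injective_iff_map_eq_zero]
    intro a ha
    have h : T (a : E) = 0 := congrArg Subtype.val ha
    have h' := a.2 T hT
    rw [h, map_zero] at h'
    exact Subtype.ext h'.symm
  rw [Submodule.mem_orthogonal]
  intro w hw
  obtain ⟨a, ha⟩ := LinearMap.injective_iff_surjective.1 hinj ⟨w, hw⟩
  have h : T (a : E) = w := congrArg Subtype.val ha
  rw [← h, ← adjoint_inner_left, a.2 T hT]
  exact (Submodule.mem_orthogonal _ _).1 hv a a.2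

/-- Poincaré recurrence: a vector of the isometric part almost returns to itself. -/
theorem exists_pow_succ_apply_near {T : E →L[ℝ] E} (hT : T ∈ K) {v : E}
    (hv : v ∈ isometricPart K) {ε : ℝ} (hε : 0 < ε) : ∃ n : ℕ, ‖(T ^ (n + 1)) v - v‖ < ε := by
  have hmem : ∀ n, (T ^ n) v ∈ Metric.closedBall (0 : E) ‖v‖ := fun n => by
    rw [mem_closedBall_zero_iff]
    exact ((mem_isometricPart hK).1 hv _ (pow_mem hT n)).le
  obtain ⟨a, -, φ, hφ, hlim⟩ := (isCompact_closedBall (0 : E) ‖v‖).tendsto_subseq hmem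
  obtain ⟨N, hN⟩ := Metric.cauchySeq_iff.1 hlim.cauchySeq ε hε
  have hlt : φ N < φ (N + 1) := hφ N.lt_succ_self
  refine ⟨φ (N + 1) - φ N - 1, ?_⟩
  have h := hN (N + 1) N.le_succ N le_rfl
  rw [dist_eq_norm] at h
  have hsplit : (T ^ φ (N + 1)) v = (T ^ φ N) ((T ^ (φ (N + 1) - φ N - 1 + 1)) v) := by
    rw [← mul_apply_eq_comp, ← pow_add]
    congr 2
    omega
  simp only [Function.comp_apply] at h
  rwa [hsplit, ← map_sub, (mem_isometricPart hK).1 _ _ (pow_mem hT _)] at h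
  exact sub_mem (apply_mem_isometricPart hK (pow_mem hT _) hv) hv

variable {C : Submonoid (E →L[ℝ] E)} (hCK : C ≤ K) (hret : ∀ T ∈ K, ∃ S ∈ K, S * T ∈ C)
include hCK hret

/-- A vector of shortest length in the closure of the `C`-orbit of `v` cannot be shortened by any
operator of `K`, since `K` can be completed to `C`; so it lies in the isometric part and in its
orthogonal complement, and is zero. -/
theorem exists_norm_apply_lt {v : E} (hv : v ∈ (isometricPart K)ᗮ) {ε : ℝ} (hε : 0 < ε) :
    ∃ T ∈ C, ‖T v‖ < ε := by
  set O : Set E := {w | ∃ T ∈ C, T v = w} with hO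
  have hv_mem : v ∈ O := ⟨1, one_mem C, rfl⟩
  have hsub : O ⊆ Metric.closedBall 0 ‖v‖ := by
    rintro _ ⟨T, hT, rfl⟩
    rw [mem_closedBall_zero_iff]
    exact (T.le_of_opNorm_le (hK T (hCK hT)) v).trans_eq (one_mul _)
  have hcomp : IsCompact (closure O) :=
    (isCompact_closedBall (0 : E) ‖v‖).of_isClosed_subset isClosed_closure
      (closure_minimal hsub Metric.isClosed_closedBall)
  obtain ⟨m, hm, hmin⟩ := hcomp.exists_isMinOn ⟨v, subset_closure hv_mem⟩ continuous_norm.continuousOn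
  have hm1 : m ∈ isometricPart K := by
    rw [mem_isometricPart hK]
    intro T hT
    refine le_antisymm ((T.le_of_opNorm_le (hK T hT) m).trans_eq (one_mul _)) ?_
    by_contra! hlt
    have hopen : IsOpen {w : E | ‖T w‖ < ‖m‖} := isOpen_lt (by fun_prop) continuous_const
    obtain ⟨_, hw, c, hc, rfl⟩ := mem_closure_iff.1 hm _ hopen hlt
    obtain ⟨S, hS, hST⟩ := hret (T * c) (mul_mem hT (hCK hc))
    have h1 : ‖m‖ ≤ ‖S (T (c v))‖ := hmin (subset_closure ⟨_, hST, rfl⟩)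
    have h2 : ‖S (T (c v))‖ ≤ ‖T (c v)‖ :=
      (S.le_of_opNorm_le (hK S hS) _).trans_eq (one_mul _)
    exact absurd hw (not_lt.2 (h1.trans h2))
  have hm2 : m ∈ (isometricPart K)ᗮ := by
    refine closure_minimal ?_ (Submodule.closed_of_finiteDimensional _) hm
    rintro _ ⟨T, hT, rfl⟩
    exact apply_mem_orthogonal_isometricPart hK (hCK hT) hv
  have hm0 : m = 0 := by
    have h := (Submodule.mem_orthogonal _ _).1 hm2 m hm1
    exact inner_self_eq_zero.1 h
  rw [hm0] at hm
  obtain ⟨_, ⟨T, hT, rfl⟩, h⟩ := Metric.mem_closure_iff.1 hm ε hε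
  exact ⟨T, hT, by rwa [dist_comm, dist_zero_right] at h⟩

/-- Some operator of the form `S * X ^ (n + 1)` with `S ∈ C` moves `v` close to its orthogonal
projection to the isometric part of `K`. The target depends on neither `X` nor `C`. -/
theorem exists_mul_pow_succ_apply_near {X : E →L[ℝ] E} (hX : X ∈ K) (v : E) {ε : ℝ}
    (hε : 0 < ε) :
    ∃ S ∈ C, ∃ n : ℕ, ‖S ((X ^ (n + 1)) v) - (isometricPart K).starProjection v‖ < ε := by
  set h := (isometricPart K).starProjection v with hh
  have hh_mem : h ∈ isometricPart K := Submodule.starProjection_apply_mem _ _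
  have hg : v - h ∈ (isometricPart K)ᗮ := Submodule.sub_starProjection_mem_orthogonal _
  obtain ⟨n, hn⟩ := exists_pow_succ_apply_near hK hX hh_mem (by positivity : 0 < ε / 3)
  have hXn := pow_mem hX (n + 1)
  obtain ⟨S, hS, hSg⟩ := exists_norm_apply_lt hK hCK hret
    (apply_mem_orthogonal_isometricPart hK hXn hg) (by positivity : 0 < ε / 3)
  obtain ⟨k, hk⟩ := exists_pow_succ_apply_near hK (hCK hS) hh_mem (by positivity : 0 < ε / 3)
  -- The powers of `X` and of `S` return the projection `h` to nearly itself, while a single factor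
  -- `S` already makes the image of `v - h` short and further factors cannot lengthen it.
  refine ⟨S ^ (k + 1), pow_mem hS _, n, ?_⟩
  have hle : ∀ T ∈ K, ∀ w, ‖T w‖ ≤ ‖w‖ := fun T hT w =>
    (T.le_of_opNorm_le (hK T hT) w).trans_eq (one_mul _)
  have h1 : ‖(S ^ (k + 1)) ((X ^ (n + 1)) (v - h))‖ < ε / 3 := by
    rw [pow_succ, mul_apply_eq_comp]
    exact (hle _ (pow_mem (hCK hS) k) _).trans_lt hSg
  have h2 : ‖(S ^ (k + 1)) ((X ^ (n + 1)) h - h)‖ < ε / 3 :=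
    (hle _ (pow_mem (hCK hS) _) _).trans_lt hn
  have hsum : (S ^ (k + 1)) ((X ^ (n + 1)) v) - h =
      (S ^ (k + 1)) ((X ^ (n + 1)) (v - h)) + (S ^ (k + 1)) ((X ^ (n + 1)) h - h) +
        ((S ^ (k + 1)) h - h) := by
    simp only [map_sub]
    abel
  rw [hsum]
  calc _ ≤ _ := norm_add₃_le
    _ < ε := by linarith

end Contractions

/-! ### Minimal automata -/

section Minimal

variable {α : Type*} {σ : Type} [Fintype σ] {D : DFA α σ} {L : Language α}

/-- Otherwise the automaton restricted to its reachable states would be smaller. -/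
theorem IsMinimalDFA.exists_eval_eq (hD : IsMinimalDFA D L) (s : σ) : ∃ w, D.eval w = s := by
  classical
  by_contra hs
  let R := {s : σ // ∃ w, D.eval w = s}
  let E : DFA α R :=
    { step := fun s a => ⟨D.step s a, s.2.elim fun w hw =>
        ⟨w ++ [a], by rw [DFA.eval_append_singleton, hw]⟩⟩
      start := ⟨D.start, [], rfl⟩
      accept := {s | (s : σ) ∈ D.accept} }
  have heval : ∀ (w : List α) (s : R), (E.evalFrom s w : σ) = D.evalFrom s w := by
    intro w
    induction w with
    | nil => exact fun _ => rfl
    | cons a w ih => exact fun s => ih (E.step s a)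
  have hE : E.accepts = L := by
    rw [← hD.1]
    ext w
    change (E.evalFrom E.start w : σ) ∈ D.accept ↔ D.evalFrom D.start w ∈ D.accept
    rw [heval]
  exact absurd (hD.2 R E hE) (not_le.2 (Fintype.card_subtype_lt hs))

/-- Otherwise identifying the states that accept the same words would give a smaller automaton. -/
theorem IsMinimalDFA.acceptsFrom_injective (hD : IsMinimalDFA D L) :
    Function.Injective D.acceptsFrom := by
  classical
  intro s₁ s₂ h
  by_contra hne
  let r : Setoid σ := Setoid.ker D.acceptsFrom
  have hstep : ∀ a (s t : σ), D.acceptsFrom s = D.acceptsFrom t →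
      D.acceptsFrom (D.step s a) = D.acceptsFrom (D.step t a) := by
    intro a s t hst
    ext w
    exact (Set.ext_iff.1 hst (a :: w) :)
  let E : DFA α (Quotient r) :=
    { step := fun s a => Quotient.map (fun s => D.step s a) (hstep a) s
      start := ⟦D.start⟧
      accept := {s | Quotient.lift (fun s => [] ∈ D.acceptsFrom s)
        (fun _ _ hst => congrArg (fun l : Language α => [] ∈ l) hst) s} }
  have heval : ∀ (w : List α) (s : σ), E.evalFrom ⟦s⟧ w = ⟦D.evalFrom s w⟧ := by
    intro w
    induction w with
    | nil => exact fun _ => rfl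
    | cons a w ih => exact fun s => ih (D.step s a)
  have hE : E.accepts = L := by
    rw [← hD.1]
    ext w
    change E.evalFrom ⟦D.start⟧ w ∈ E.accept ↔ D.evalFrom D.start w ∈ D.accept
    rw [heval]
    rfl
  exact absurd (hD.2 (Quotient r) E hE) (not_le.2 (Fintype.card_lt_of_surjective_not_injective
    (Quotient.mk r) Quotient.mk_surjective fun hinj => hne (hinj (Quotient.sound h))))

end Minimal

/-! ### Reversible automata as contractions -/

open scoped Computability in
theorem Language.append_mem_kstar {α : Type*} {l : Language α} : ∀ u ∈ l∗, ∀ v ∈ l∗, u ++ v ∈ l∗ := by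
  intro u hu v hv
  rw [← kstar_mul_kstar]
  exact Language.append_mem_mul hu hv

namespace PRAC

variable {α Q : Type*} [Fintype α] [Fintype Q] (A : PRAC α Q)

/-- The transition matrices are doubly stochastic, hence contractions of the Euclidean norm. -/
theorem sum_sq_mulVec_le (σ : TapeSymbol α) (v : Q → ℝ) :
    ∑ i, ((A.V σ).mulVec v i) ^ 2 ≤ ∑ i, v i ^ 2 := by
  have h : ∀ i, ((A.V σ).mulVec v i) ^ 2 ≤ ∑ j, A.δ j σ i * v j ^ 2 := fun i => by
    have := Finset.sum_sq_le_sum_mul_sum_of_sq_le_mul Finset.univ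
      (r := fun j => A.δ j σ i * v j) (f := fun j => A.δ j σ i) (g := fun j => A.δ j σ i * v j ^ 2)
      (fun j _ => (A.δ_mem j σ i).1) (fun j _ => mul_nonneg (A.δ_mem j σ i).1 (sq_nonneg _))
      (fun j _ => le_of_eq (by ring))
    rwa [A.sum_in, one_mul] at this
  calc ∑ i, ((A.V σ).mulVec v i) ^ 2 ≤ ∑ i, ∑ j, A.δ j σ i * v j ^ 2 :=
        Finset.sum_le_sum fun i _ => h i
    _ = ∑ j, v j ^ 2 := by
        rw [Finset.sum_comm]
        refine Finset.sum_congr rfl fun j _ => ?_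
        rw [← Finset.sum_mul, A.sum_out, one_mul]

open Classical in
/-- The operator on Euclidean space describing the reading of `u`; the first symbol of `u` acts
first, so the factors appear in reverse order. -/
noncomputable def wordOp (u : List (TapeSymbol α)) :
    EuclideanSpace ℝ Q →L[ℝ] EuclideanSpace ℝ Q :=
  (u.reverse.map fun σ => Matrix.toEuclideanCLM (𝕜 := ℝ) (A.V σ)).prod

@[simp]
theorem wordOp_nil : A.wordOp [] = 1 := by simp [wordOp]

theorem wordOp_append (u v : List (TapeSymbol α)) :
    A.wordOp (u ++ v) = A.wordOp v * A.wordOp u := by simp [wordOp]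

open Classical in
theorem wordOp_singleton (σ : TapeSymbol α) :
    A.wordOp [σ] = Matrix.toEuclideanCLM (𝕜 := ℝ) (A.V σ) := by simp [wordOp]

theorem wordOp_cons (σ : TapeSymbol α) (u : List (TapeSymbol α)) :
    A.wordOp (σ :: u) = A.wordOp u * A.wordOp [σ] := A.wordOp_append [σ] u

theorem ofLp_wordOp (u : List (TapeSymbol α)) (v : EuclideanSpace ℝ Q) :
    (A.wordOp u v).ofLp = A.evolve v.ofLp u := by
  classical
  induction u generalizing v with
  | nil => simp [evolve]
  | cons σ u ih =>
    rw [wordOp_cons, mul_apply_eq_comp, ih, wordOp_singleton,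
      Matrix.ofLp_toEuclideanCLM]
    rfl

theorem norm_wordOp_le (u : List (TapeSymbol α)) : ‖A.wordOp u‖ ≤ 1 := by
  classical
  induction u with
  | nil => exact ContinuousLinearMap.norm_id_le
  | cons σ u ih =>
    rw [wordOp_cons]
    refine (norm_mul_le _ _).trans (mul_le_one₀ ih (norm_nonneg _) ?_)
    refine ContinuousLinearMap.opNorm_le_bound _ zero_le_one fun v => ?_
    rw [one_mul, EuclideanSpace.norm_eq, EuclideanSpace.norm_eq, wordOp_singleton,
      Matrix.ofLp_toEuclideanCLM]
    refine Real.sqrt_le_sqrt ?_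
    simpa only [Real.norm_eq_abs, sq_abs] using A.sum_sq_mulVec_le σ v.ofLp

/-- The distribution after the left end-marker, as a vector of Euclidean space. -/
noncomputable def afterLeftEnd : EuclideanSpace ℝ Q :=
  A.wordOp [TapeSymbol.leftEnd] (WithLp.toLp 2 A.initDist)

theorem finalDist_append (u z : List α) :
    A.finalDist (u ++ z) =
      (A.wordOp (z.map TapeSymbol.letter ++ [TapeSymbol.rightEnd])
        (A.wordOp (u.map TapeSymbol.letter) A.afterLeftEnd)).ofLp := by
  rw [afterLeftEnd, ← mul_apply_eq_comp,
    ← mul_apply_eq_comp, mul_assoc, ← wordOp_append, ← wordOp_append,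
    ofLp_wordOp, finalDist]
  simp [tapeOf]

/-- Reading a common suffix does not separate acceptance probabilities by more than a constant
multiple of the distance between the distributions before the suffix. -/
theorem abs_acceptProb_sub_le (u v z : List α) :
    |(A.acceptProb (u ++ z) : ℝ) - A.acceptProb (v ++ z)| ≤
      Fintype.card Q * ‖A.wordOp (u.map TapeSymbol.letter) A.afterLeftEnd -
        A.wordOp (v.map TapeSymbol.letter) A.afterLeftEnd‖ := by
  classical
  set d := A.wordOp (u.map TapeSymbol.letter) A.afterLeftEnd -
    A.wordOp (v.map TapeSymbol.letter) A.afterLeftEnd with hd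
  set T := A.wordOp (z.map TapeSymbol.letter ++ [TapeSymbol.rightEnd])
  have hTd : ‖T d‖ ≤ ‖d‖ :=
    (T.le_of_opNorm_le (A.norm_wordOp_le _) d).trans_eq (one_mul _)
  have hsub : (A.acceptProb (u ++ z) : ℝ) - A.acceptProb (v ++ z) =
      ∑ q with q ∈ A.accept, (T d) q := by
    simp only [acceptProb, finalDist_append]
    rw [← Finset.sum_sub_distrib, hd, map_sub]
    rfl
  rw [hsub]
  calc |∑ q with q ∈ A.accept, (T d) q| ≤ ∑ q with q ∈ A.accept, |(T d) q| :=
        Finset.abs_sum_le_sum_abs _ _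
    _ ≤ ∑ q, |(T d) q| := Finset.sum_le_univ_sum_of_nonneg fun _ => abs_nonneg _
    _ ≤ ∑ _q : Q, ‖d‖ := Finset.sum_le_sum fun q _ =>
        (PiLp.norm_apply_le (T d) q).trans hTd
    _ = Fintype.card Q * ‖d‖ := by simp

/-- The operators of the words of a language that is closed under concatenation. -/
def opSubmonoid (W : Language α) (h1 : [] ∈ W) (hmul : ∀ u ∈ W, ∀ v ∈ W, u ++ v ∈ W) :
    Submonoid (EuclideanSpace ℝ Q →L[ℝ] EuclideanSpace ℝ Q) where
  carrier := {T | ∃ u ∈ W, A.wordOp (u.map TapeSymbol.letter) = T}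
  one_mem' := ⟨[], h1, by simp⟩
  mul_mem' := by
    rintro _ _ ⟨u, hu, rfl⟩ ⟨v, hv, rfl⟩
    exact ⟨v ++ u, hmul v hv u hu, by rw [List.map_append, wordOp_append]⟩

open scoped Computability

/-- If `s` can be re-entered from wherever the words over `l` lead, then some word takes `q` to `s`
while its operator takes `v` close to a vector that depends on `l` and `v` only, not on `s`: the
word is a power of `x` followed by a loop at `s`. -/
theorem exists_word_near {σ : Type*} (D : DFA α σ) (l : Language α) {q s : σ} {x : List α}
    (hx : x ∈ l) (hqx : D.evalFrom q x = s) (hsx : D.evalFrom s x = s)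
    (hret : ∀ t ∈ l∗, ∃ t' ∈ l∗, D.evalFrom s (t ++ t') = s)
    (v : EuclideanSpace ℝ Q) {ε : ℝ} (hε : 0 < ε) :
    ∃ u : List α, D.evalFrom q u = s ∧ ‖A.wordOp (u.map TapeSymbol.letter) v -
      (isometricPart (A.opSubmonoid l∗ (Language.nil_mem_kstar l)
        Language.append_mem_kstar)).starProjection v‖ < ε := by
  set K := A.opSubmonoid l∗ (Language.nil_mem_kstar l) Language.append_mem_kstar
  let C := A.opSubmonoid {u | u ∈ l∗ ∧ D.evalFrom s u = s} ⟨Language.nil_mem_kstar l, rfl⟩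
    fun u hu v hv => ⟨Language.append_mem_kstar u hu.1 v hv.1, by
      rw [DFA.evalFrom_of_append, hu.2, hv.2]⟩
  have hK : ∀ T ∈ K, ‖T‖ ≤ 1 := by
    rintro _ ⟨u, -, rfl⟩
    exact A.norm_wordOp_le _
  have hCK : C ≤ K := by
    rintro _ ⟨u, hu, rfl⟩
    exact ⟨u, hu.1, rfl⟩
  have hKC : ∀ T ∈ K, ∃ S ∈ K, S * T ∈ C := by
    rintro _ ⟨t, ht, rfl⟩
    obtain ⟨t', ht', h⟩ := hret t ht
    exact ⟨_, ⟨t', ht', rfl⟩, t ++ t', ⟨Language.append_mem_kstar t ht t' ht', h⟩, by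
      rw [List.map_append, wordOp_append]⟩
  have hX : A.wordOp (x.map TapeSymbol.letter) ∈ K :=
    ⟨x, Language.mem_kstar.2 ⟨[x], by simp, by simpa using hx⟩, rfl⟩
  obtain ⟨_, ⟨c, hc, rfl⟩, n, hn⟩ := exists_mul_pow_succ_apply_near hK hCK hKC hX v hε
  have hpow : ∀ n : ℕ, ∃ u : List α, D.evalFrom q u = s ∧
      A.wordOp (u.map TapeSymbol.letter) = A.wordOp (x.map TapeSymbol.letter) ^ (n + 1) := by
    intro n
    induction n with
    | zero => exact ⟨x, hqx, (pow_one _).symm⟩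
    | succ n ih =>
      obtain ⟨u, hu, hun⟩ := ih
      refine ⟨u ++ x, by rw [DFA.evalFrom_of_append, hu, hsx], ?_⟩
      rw [List.map_append, wordOp_append, hun, ← pow_succ']
  obtain ⟨u, hu, hun⟩ := hpow n
  refine ⟨u ++ c, by rw [DFA.evalFrom_of_append, hu]; exact hc.2, ?_⟩
  rwa [List.map_append, wordOp_append, hun]

end PRAC

/-! ### Languages of type `(*)` -/

theorem mainTheorem1 {α : Type*} [Fintype α] (L : Language α) (hreg : L.IsRegular)
    (hL : IsOfTypeStar L) {Q : Type*} [Fintype Q] (A : PRAC α Q) :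
    ¬ A.RecognizesWithBoundedError L := by
  rintro ⟨p₁, p₂, hp, hp₁, hp₂⟩
  obtain ⟨σ, _, D, hD, q, q₁, q₂, x, y, hne, hqx, hqy, hx, hy, hret₁, hret₂⟩ := hL
  have hgap : ∀ w ∈ L, ∀ w' ∉ L, (p₂ : ℝ) - p₁ ≤ A.acceptProb w - A.acceptProb w' := by
    intro w hw w' hw'
    have h1 : (A.acceptProb w' : ℝ) ≤ p₁ := hp₁.1 ⟨w', hw', rfl⟩
    have h2 : (p₂ : ℝ) ≤ A.acceptProb w := hp₂.1 ⟨w, hw, rfl⟩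
    linarith
  obtain ⟨w, hw⟩ := hD.exists_eval_eq q
  obtain ⟨z, hz⟩ : ∃ z, ¬ (z ∈ D.acceptsFrom q₁ ↔ z ∈ D.acceptsFrom q₂) := by
    by_contra! h
    exact hne (hD.acceptsFrom_injective (Set.ext h))
  have hmem : ∀ u, w ++ u ++ z ∈ L ↔ z ∈ D.acceptsFrom (D.evalFrom q u) := by
    intro u
    rw [← hD.1, DFA.mem_accepts, DFA.mem_acceptsFrom, DFA.eval, DFA.evalFrom_of_append,
      DFA.evalFrom_of_append, ← DFA.eval, hw]
  have hpos : (0 : ℝ) < p₂ - p₁ := sub_pos.2 hp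
  obtain ⟨ε, hε, hεlt⟩ : ∃ ε : ℝ, 0 < ε ∧ Fintype.card Q * (2 * ε) < (p₂ : ℝ) - p₁ := by
    refine ⟨((p₂ : ℝ) - p₁) / (2 * (Fintype.card Q + 1)), by positivity, ?_⟩
    field_simp
    linarith
  set v := A.wordOp (w.map TapeSymbol.letter) A.afterLeftEnd with hv
  obtain ⟨u₁, hu₁, hn₁⟩ := A.exists_word_near D {x, y} (Or.inl rfl) hqx hx hret₁ v hε
  obtain ⟨u₂, hu₂, hn₂⟩ := A.exists_word_near D {x, y} (Or.inr rfl) hqy hy hret₂ v hε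
  have hclose : |(A.acceptProb (w ++ u₁ ++ z) : ℝ) - A.acceptProb (w ++ u₂ ++ z)| <
      p₂ - p₁ := by
    refine (A.abs_acceptProb_sub_le _ _ z).trans_lt (lt_of_le_of_lt ?_ hεlt)
    refine mul_le_mul_of_nonneg_left ?_ (Nat.cast_nonneg _)
    rw [List.map_append, List.map_append, A.wordOp_append, A.wordOp_append,
      mul_apply_eq_comp, mul_apply_eq_comp, ← hv,
      two_mul, ← dist_eq_norm]
    rw [← dist_eq_norm] at hn₁ hn₂
    exact (dist_triangle_right _ _ _).trans (add_le_add hn₁.le hn₂.le)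
  have h₁ := hmem u₁
  have h₂ := hmem u₂
  rw [hu₁] at h₁
  rw [hu₂] at h₂
  rw [← h₁, ← h₂] at hz
  rw [abs_lt] at hclose
  by_cases hc : w ++ u₁ ++ z ∈ L
  · have := hgap _ hc _ fun h => hz (iff_of_true hc h)
    linarith
  · have := hgap _ (by_contra fun h => hz (iff_of_false hc h)) _ hc
    linarith
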